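/- Conventions. A subshift $(X,\sigma_X)$ is a closed shift-invariant subset $X\subseteq\mathcal A^{\mathbb Z}$, $\mathcal A$ a finite discrete alphabet, with the restriction $\sigma_X$ of the shift $(\sigma x)_i=x_{i+1}$. It is a shift of finite type if $X$ is the set of all sequences in $\mathcal A^{\mathbb Z}$ that contain no word from some finite set of words. Let $\mathcal L_m(X)$ be the set of words of length $m$ appearing in points of $X$, and $\mathcal L(X)=\bigcup_{m\ge1}\mathcal L_m(X)$; $X$ is mixing if for all $u,v\in\mathcal L(X)$ there is $M$ such that for every $m\ge M$ there is $w\in\mathcal L_m(X)$ with $uwv\in\mathcal L(X)$. A (non-empty) mixing shift of finite type is non-trivial if it does not consist of only one finite orbit. For a homeomorphism $T$ of a compact metrizable space $X$, $\mathrm{Aut}^{(\infty)}(T)=\bigcup_{n\ge1}\mathrm{Aut}(T^n)$ is the group of self-homeomorphisms of $X$ that commute with some power $T^n$, $n\ge1$, and $h_{top}(T)$ is the topological entropy. A leveled group $(G,g)$ is a group $G$ with an element $g\in G$ that generates an infinite cyclic subgroup; an isomorphism of leveled groups $(G,g)\to(H,h)$ is a group isomorphism $\Phi\colon G\to H$ with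 $\Phi(g)=h$. Theorem. Let $(X_A,\sigma_A)$ and $(X_B,\sigma_B)$ be non-trivial mixing shifts of finite type, and suppose that for some nonzero integers $k,j$ there is an isomorphism of leveled groups $$\Phi\colon\bigl(\mathrm{Aut}^{(\infty)}(\sigma_A),\sigma_A^{k}\bigr)\to\bigl(\mathrm{Aut}^{(\infty)}(\sigma_B),\sigma_B^{j}\bigr).$$ Then $h_{top}(\sigma_A)$ and $h_{top}(\sigma_B)$ are finite and positive, and $$\frac{h_{top}(\sigma_A)}{h_{top}(\sigma_B)}=\frac{|j|}{|k|}\in\mathbb Q .$$ -/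

import Mathlib

namespace SymbDyn

open SymbolicDynamics.FullShift (Subshift)

/-! ### Automorphisms of a dynamical system -/

section Automorphisms

variable {X : Type*} [TopologicalSpace X]

/-- The automorphism group of `(X, T)`: the self-homeomorphisms of `X` commuting with `T`. -/
def autGroup (T : X ≃ₜ X) : Subgroup (X ≃ₜ X) := Subgroup.centralizer {T}

theorem mem_autGroup {T φ : X ≃ₜ X} : φ ∈ autGroup T ↔ Commute T φ := by
  simp [autGroup, Subgroup.mem_centralizer_iff, Commute, SemiconjBy]

/-- The stabilized automorphism group of `(X, T)`: the union over `n ≥ 1` of the automorphism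
groups of `(X, T ^ n)`, inside the group of all self-homeomorphisms of `X`. -/
def stabAutGroup (T : X ≃ₜ X) : Subgroup (X ≃ₜ X) where
  carrier := ⋃ n ∈ Set.Ici (1 : ℕ), (autGroup (T ^ n) : Set (X ≃ₜ X))
  one_mem' := Set.mem_biUnion (x := 1) (Set.mem_Ici.2 le_rfl) (one_mem (autGroup (T ^ 1)))
  mul_mem' := by
    intro φ ψ hφ hψ
    simp only [Set.mem_iUnion, Set.mem_Ici, SetLike.mem_coe, mem_autGroup] at hφ hψ ⊢
    obtain ⟨m, hm, hφ⟩ := hφ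
    obtain ⟨n, hn, hψ⟩ := hψ
    refine ⟨m * n, Nat.mul_pos hm hn, Commute.mul_right ?_ ?_⟩
    · rw [pow_mul]; exact hφ.pow_left n
    · rw [mul_comm, pow_mul]; exact hψ.pow_left m
  inv_mem' := by
    intro φ hφ
    simp only [Set.mem_iUnion, Set.mem_Ici, SetLike.mem_coe, mem_autGroup] at hφ ⊢
    obtain ⟨m, hm, hφ⟩ := hφ
    exact ⟨m, hm, hφ.inv_right⟩

theorem self_mem_stabAutGroup (T : X ≃ₜ X) : T ∈ stabAutGroup T :=
  Set.mem_biUnion (x := 1) (Set.mem_Ici.2 le_rfl)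
    (mem_autGroup.2 (by rw [pow_one]) : T ∈ autGroup (T ^ 1))

/-- `T` itself, as an element of its stabilized automorphism group. -/
def stabSelf (T : X ≃ₜ X) : stabAutGroup T := ⟨T, self_mem_stabAutGroup T⟩

/-- The topological entropy of a self-map of a compact Hausdorff space, computed with the unique
uniform structure that is compatible with the topology. -/
noncomputable def topEntropy [CompactSpace X] [T2Space X] (T : X → X) : EReal :=
  @Dynamics.coverEntropy X uniformSpaceOfCompactR1 T Set.univ

end Automorphisms

/-! ### Leveled groups -/

/-- A leveled group `(G, g)`: a group with a distinguished element which generates an infinite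
(cyclic) subgroup. -/
structure LeveledGroup.{u} where
  /-- the underlying group -/
  carrier : Type u
  [group : Group carrier]
  /-- the distinguished element -/
  level : carrier
  infinite_zpowers : Infinite (Subgroup.zpowers level)

attribute [instance] LeveledGroup.group

/-- An isomorphism of leveled groups `(G, g) → (H, h)`: a group isomorphism taking `g` to `h`. -/
structure LeveledGroup.Iso (G H : LeveledGroup) extends G.carrier ≃* H.carrier where
  map_level : toFun G.level = H.level

/-! ### Subshifts -/

section Subshifts

variable {A : Type*}

/-- The word `w` occurs in the bi-infinite sequence `x`, starting at coordinate `i`. -/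
def OccursAt (w : List A) (x : ℤ → A) (i : ℤ) : Prop :=
  ∀ (n : ℕ) (hn : n < w.length), x (i + n) = w[n]

variable [TopologicalSpace A]

/-- The shift map `(σ x) i = x (i + 1)`, as a self-homeomorphism of a subshift. -/
def shiftHomeo (X : Subshift A ℤ) : X.carrier ≃ₜ X.carrier where
  toFun x := ⟨fun i => x.1 (i + 1), by
    have h := X.mapsTo 1 x.2
    have e : SymbolicDynamics.FullShift.shift 1 x.1 = fun i => x.1 (i + 1) := by
      funext i
      simp [add_comm]
    rwa [e] at h⟩
  invFun x := ⟨fun i => x.1 (i - 1), by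
    have h := X.mapsTo (-1) x.2
    have e : SymbolicDynamics.FullShift.shift (-1) x.1 = fun i => x.1 (i - 1) := by
      funext i
      simp [sub_eq_neg_add]
    rwa [e] at h⟩
  left_inv x := by ext i; simp
  right_inv x := by ext i; simp
  continuous_toFun := by
    refine Continuous.subtype_mk (continuous_pi fun i => ?_) _
    exact (continuous_apply (i + 1)).comp continuous_subtype_val
  continuous_invFun := by
    refine Continuous.subtype_mk (continuous_pi fun i => ?_) _
    exact (continuous_apply (i - 1)).comp continuous_subtype_val

instance (X : Subshift A ℤ) [Finite A] : CompactSpace X.carrier :=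
  isCompact_iff_compactSpace.1 X.isClosed.isCompact

/-- The words of length `m` appearing in points of the subshift. -/
def wordsOfLength (X : Subshift A ℤ) (m : ℕ) : Set (List A) :=
  {w | w.length = m ∧ ∃ x ∈ X.carrier, OccursAt w x 1}

/-- The language of a subshift: all its words of positive length. -/
def language (X : Subshift A ℤ) : Set (List A) :=
  ⋃ m ∈ Set.Ici (1 : ℕ), wordsOfLength X m

/-- Mixing: any two words of the language can be joined by words of every large length. -/
def IsMixing (X : Subshift A ℤ) : Prop :=
  ∀ u ∈ language X, ∀ v ∈ language X, ∃ M : ℕ, ∀ m ≥ M,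
    ∃ w ∈ wordsOfLength X m, u ++ w ++ v ∈ language X

/-- Shift of finite type: the sequences avoiding some finite set of words. -/
def IsFiniteType (X : Subshift A ℤ) : Prop :=
  ∃ F : Set (List A), F.Finite ∧ ∀ x : ℤ → A, x ∈ X.carrier ↔ ∀ w ∈ F, ∀ i, ¬ OccursAt w x i

/-- The subshift consists of only one finite orbit. -/
def IsSingleFiniteOrbit (X : Subshift A ℤ) : Prop :=
  ∃ x : X.carrier, (Set.range fun n : ℤ => (shiftHomeo X ^ n) x) = Set.univ ∧ Finite X.carrier

/-- Non-trivial mixing shifts of finite type. -/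
structure IsNontrivialMixingSFT (X : Subshift A ℤ) : Prop where
  nonempty : X.carrier.Nonempty
  finiteType : IsFiniteType X
  mixing : IsMixing X
  nontrivial : ¬ IsSingleFiniteOrbit X

theorem shiftHomeo_pow_apply (X : Subshift A ℤ) (n : ℕ) (x : X.carrier) (i : ℤ) :
    ((shiftHomeo X ^ n) x).1 i = x.1 (i + n) := by
  induction n generalizing x with
  | zero => simp
  | succ n ih =>
    rw [pow_succ, Homeomorph.mul_apply, ih]
    simp [shiftHomeo, add_assoc]

theorem shiftHomeo_pow_ne_one {X : Subshift A ℤ} (hX : IsNontrivialMixingSFT X) {n : ℕ}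
    (hn : 0 < n) : shiftHomeo X ^ n ≠ 1 := by
  intro h
  have per : ∀ (x : X.carrier) (i : ℤ), x.1 (i + n) = x.1 i := fun x i => by
    rw [← shiftHomeo_pow_apply, h]; rfl
  have perk : ∀ (x : X.carrier) (k : ℕ) (i : ℤ), x.1 (i + k * n) = x.1 i := fun x k => by
    induction k with
    | zero => simp
    | succ k ih =>
      intro i
      refine (congrArg x.1 ?_).trans ((per x (i + k * n)).trans (ih i))
      push_cast
      ring
  have occ : ∀ x : X.carrier, (List.ofFn fun t : Fin n => x.1 (1 + (t : ℕ))) ∈ language X := by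
    intro x
    refine Set.mem_biUnion (x := n) (Set.mem_Ici.2 hn) ⟨by simp, x.1, x.2, ?_⟩
    intro t ht
    simp
  have key : ∀ x y : X.carrier, x = y := by
    intro x y
    obtain ⟨M, hM⟩ := hX.mixing _ (occ x) _ (occ y)
    obtain ⟨w, hw, hmem⟩ := hM (M * n) (Nat.le_mul_of_pos_right M hn)
    simp only [language, Set.mem_iUnion] at hmem
    obtain ⟨m, -, -, z, hz, hoc⟩ := hmem
    have hwl : w.length = M * n := hw.1
    have small : ∀ t : ℕ, t < n → x.1 (1 + t) = y.1 (1 + t) := by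
      intro t ht
      have h1 := hoc t (by simp; omega)
      have h2 := hoc (n + M * n + t) (by simp [hwl]; omega)
      rw [List.getElem_append_left (by simp; omega), List.getElem_append_left (by simpa)] at h1
      rw [List.getElem_append_right (by simp [hwl])] at h2
      simp only [List.getElem_ofFn, List.length_append, List.length_ofFn, hwl,
        Nat.add_sub_cancel_left] at h1 h2
      rw [← h1, ← h2]
      have h3 := perk ⟨z, hz⟩ (M + 1) (1 + t)
      simp only at h3
      rw [← h3]
      congr 1
      push_cast
      ring
    have red : ∀ (x : X.carrier) (i : ℤ), x.1 i = x.1 (1 + ((i - 1) % n).toNat) := by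
      intro x i
      have hpos : (0 : ℤ) < n := by exact_mod_cast hn
      rw [Int.toNat_of_nonneg (Int.emod_nonneg _ hpos.ne')]
      have hd := Int.mul_ediv_add_emod (i - 1) n
      obtain ⟨k, hk | hk⟩ := Int.eq_nat_or_neg ((i - 1) / n)
      · rw [hk] at hd
        exact (congrArg x.1 (by linarith [mul_comm (n : ℤ) k])).trans (perk x k _)
      · rw [hk, mul_neg] at hd
        exact ((congrArg x.1 (by linarith [mul_comm (n : ℤ) k])).trans (perk x k i)).symm
    apply Subtype.ext
    funext i
    rw [red x, red y]
    apply small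
    have hpos : (0 : ℤ) < n := by exact_mod_cast hn
    have := Int.emod_lt_of_pos (i - 1) hpos
    have := Int.emod_nonneg (i - 1) hpos.ne'
    omega
  obtain ⟨x, hx⟩ := hX.nonempty
  have : Subsingleton X.carrier := ⟨key⟩
  exact hX.nontrivial ⟨⟨x, hx⟩, Set.eq_univ_of_forall fun y => ⟨0, key _ _⟩, inferInstance⟩

/-- The leveled stabilized automorphism group of a non-trivial mixing shift of finite type, with
distinguished element the `k`-th power of the shift, `k ≠ 0`. -/
def leveledStabAut (X : Subshift A ℤ) (hX : IsNontrivialMixingSFT X) (k : ℤ) (hk : k ≠ 0) :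
    LeveledGroup where
  carrier := stabAutGroup (shiftHomeo X)
  level := stabSelf (shiftHomeo X) ^ k
  infinite_zpowers := by
    refine Set.infinite_coe_iff.2 (infinite_zpowers.2 ?_)
    rw [isOfFinOrder_iff_zpow_eq_one]
    rintro ⟨n, hn, h⟩
    rw [← zpow_mul] at h
    have h' : shiftHomeo X ^ (k * n) = 1 := by
      simpa [stabSelf] using congrArg Subtype.val h
    have hkn : k * n ≠ 0 := mul_ne_zero hk hn
    refine shiftHomeo_pow_ne_one hX (Int.natAbs_pos.2 hkn) ?_
    rw [← zpow_natCast]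
    rcases Int.natAbs_eq (k * n) with e | e
    · rw [← e, h']
    · rw [show ((k * n).natAbs : ℤ) = -(k * n) by omega, zpow_neg, h', inv_one]

end Subshifts

end SymbDyn

namespace SymbDyn

open SymbolicDynamics.FullShift (Subshift)

/-! ### Words, windows and specification -/

section Words

variable {A : Type*} [TopologicalSpace A]

/-! Write K = |k|, J = |j|. Membership in Aut(σ^{Kn}) means commuting with the n-th power of the
level, up to sign, so Φ carries Aut(σ_A^{Kn}) into Aut(σ_B^{Jn}) for every n. The entropies are
compared through finite groups inside these.

On the A side, permuting the words of length n + l with fixed prefix and suffix of length l, block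
by block, gives elements of Aut(σ_A^n) (`blockHom`). They form a product of symmetric groups on sets
of at least `wordCount X (n - C)` elements (`HasGap.wordCount_le_card_fiber`). On the B side,
Aut(σ_B^n) acts on the fixed points of σ_B^n, of which there are at most `wordCount Y n` (`fixHom`,
`card_fixedPoint_le`). If the composed action is nontrivial on some square, then by simplicity some
alternating group embeds, and a factorial count shows that its set is no larger than the set of
fixed points (`exists_card_le_of_map_mul_self_ne_one`).

Nontriviality must hold at infinitely many levels at once. A block automorphism of one level is one
of every multiple level (`exists_blockHom_mul_eq`), so a single b with b² ≠ 1 is kept. Periodic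
points are dense, so Φ(b²) moves some periodic point, and this point is fixed by σ_B^n for all n
divisible by its period. Taking logarithms along such levels gives K h(σ_A) ≤ J h(σ_B), since
entropy is the growth rate of the number of words. The inverse of Φ gives the reverse inequality. -/

theorem shift_mem {X : Subshift A ℤ} {x : ℤ → A} (hx : x ∈ X.carrier) (n : ℤ) :
    (fun i => x (i + n)) ∈ X.carrier := by
  have h := X.mapsTo n hx
  have e : SymbolicDynamics.FullShift.shift n x = fun i => x (i + n) := by
    funext i
    simp [add_comm]
  rwa [e] at h

theorem shiftHomeo_zpow_apply (X : Subshift A ℤ) (n : ℤ) (x : X.carrier) (i : ℤ) :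
    ((shiftHomeo X ^ n) x).1 i = x.1 (i + n) := by
  obtain ⟨m, rfl | rfl⟩ := n.eq_nat_or_neg
  · rw [zpow_natCast, shiftHomeo_pow_apply]
  · obtain ⟨y, rfl⟩ : ∃ y, (shiftHomeo X ^ m) y = x := ⟨(shiftHomeo X ^ m).symm x, by simp⟩
    rw [← Homeomorph.mul_apply, zpow_neg, zpow_natCast, inv_mul_cancel, shiftHomeo_pow_apply]
    simp

/-- The words of length `N` occurring in points of `X`, as functions on `Fin N`. -/
abbrev Words (X : Subshift A ℤ) (N : ℕ) : Type _ :=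
  {w : Fin N → A // ∃ x : X.carrier, ∀ s : Fin N, x.1 (s : ℕ) = w s}

variable {X : Subshift A ℤ}

/-- The word of length `N` that occurs in `x` at coordinate `i`. -/
def block (N : ℕ) (x : X.carrier) (i : ℤ) : Words X N :=
  ⟨fun s => x.1 (i + (s : ℕ)), (shiftHomeo X ^ i) x, fun s => by
    rw [shiftHomeo_zpow_apply, add_comm]⟩

theorem block_eq_iff {N : ℕ} {x y : X.carrier} {i j : ℤ} :
    block N x i = block N y j ↔ ∀ s : ℕ, s < N → x.1 (i + s) = y.1 (j + s) := by
  constructor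
  · intro h s hs
    exact congrFun (congrArg Subtype.val h) ⟨s, hs⟩
  · intro h
    exact Subtype.ext (funext fun s => h s s.2)

theorem block_shift (N : ℕ) (x : X.carrier) (i n : ℤ) :
    block N ((shiftHomeo X ^ n) x) i = block N x (i + n) := by
  rw [block_eq_iff]
  intro s _
  rw [shiftHomeo_zpow_apply, add_right_comm]

theorem exists_block_eq {N : ℕ} (w : Words X N) (i : ℤ) : ∃ x : X.carrier, block N x i = w := by
  obtain ⟨w, x, hx⟩ := w
  refine ⟨(shiftHomeo X ^ (-i)) x, ?_⟩
  rw [block_shift]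
  refine Subtype.ext (funext fun s => ?_)
  simp [block, hx]

/-- The subword of length `N` starting at position `a`. -/
noncomputable def subword {M : ℕ} (a N : ℕ) (_h : a + N ≤ M) (w : Words X M) : Words X N :=
  block N w.2.choose a

/-- The result does not depend on the point chosen to represent the word. -/
theorem subword_block {M : ℕ} (a N : ℕ) (h : a + N ≤ M) (x : X.carrier) (i : ℤ) :
    subword a N h (block M x i) = block N x (i + a) := by
  rw [subword, block_eq_iff]
  intro s hs
  have := (block M x i).2.choose_spec ⟨a + s, by omega⟩
  simpa [block, add_assoc] using this

instance [Finite A] (N : ℕ) : Finite (Words X N) := Subtype.finite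

theorem continuous_block [DiscreteTopology A] (N : ℕ) (i : ℤ) :
    Continuous fun x : X.carrier => block N x i :=
  Continuous.subtype_mk (f := fun (x : X.carrier) (s : Fin N) => x.1 (i + (s : ℕ)))
    (continuous_pi fun s => (continuous_apply (i + ((s : ℕ) : ℤ))).comp continuous_subtype_val) _

/-- A sequence belongs to `X` as soon as all its windows of length `l + 1` are words of `X`. -/
def HasWindow (X : Subshift A ℤ) (l : ℕ) : Prop :=
  ∀ x : ℤ → A, (∀ i : ℤ, ∃ y : X.carrier, ∀ t, i ≤ t → t ≤ i + l → x t = y.1 t) → x ∈ X.carrier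

/-- Any left half of a point can be joined to any right half of a point across a gap of
length `g`. -/
def HasGap (X : Subshift A ℤ) (g : ℕ) : Prop :=
  ∀ (x y : X.carrier) (i : ℤ), ∃ z : X.carrier,
    (∀ t, t < i → z.1 t = x.1 t) ∧ ∀ t, i + g ≤ t → z.1 t = y.1 t

theorem IsFiniteType.exists_hasWindow (h : IsFiniteType X) : ∃ l : ℕ, 0 < l ∧ HasWindow X l := by
  obtain ⟨F, hF, hX⟩ := h
  obtain ⟨L, hL⟩ := (hF.image List.length).bddAbove
  -- A window of L + 2 letters contains every forbidden word; the extra room keeps l positive, as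
  -- words of the language must be nonempty.
  refine ⟨L + 1, L.succ_pos, fun x hx => (hX x).2 fun w hw i hoc => ?_⟩
  obtain ⟨y, hy⟩ := hx i
  have hlen : w.length ≤ L := hL ⟨w, hw, rfl⟩
  refine (hX y.1).1 y.2 w hw i fun n hn => ?_
  rw [← hy _ (by omega) (by push_cast; omega)]
  exact hoc n hn

/-- With an overlap of length l, each window of length l + 1 lies entirely where the glued sequence
equals x or entirely where it equals y. -/
theorem HasWindow.glue {l : ℕ} (h : HasWindow X l) (x y : X.carrier) (i : ℤ)
    (hxy : ∀ t, i ≤ t → t < i + l → x.1 t = y.1 t) :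
    ∃ z : X.carrier, (∀ t, t < i + l → z.1 t = x.1 t) ∧ ∀ t, i ≤ t → z.1 t = y.1 t := by
  have key : ∀ t, i ≤ t → (if t < i + l then x.1 t else y.1 t) = y.1 t := by
    intro t ht
    split_ifs with h1
    · exact hxy t ht h1
    · rfl
  refine ⟨⟨fun t => if t < i + l then x.1 t else y.1 t, h _ fun s => ?_⟩,
    fun t ht => if_pos ht, key⟩
  by_cases hs : s < i
  · exact ⟨x, fun t h1 h2 => if_pos (by omega)⟩
  · exact ⟨y, fun t h1 h2 => key t (by omega)⟩

theorem ofFn_mem_language {l : ℕ} (hl : 0 < l) (u : Words X l) : List.ofFn u.1 ∈ language X := by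
  obtain ⟨x, rfl⟩ := exists_block_eq u 1
  refine Set.mem_biUnion (x := l) (Set.mem_Ici.2 hl) ⟨by simp, x.1, x.2, fun n hn => ?_⟩
  simp [block]

/-- There are finitely many pairs of words of length l, so one gap length serves them all. Since
windows have length l + 1, the connecting word can then be glued to the two half-points along
overlaps of length l. -/
theorem IsMixing.exists_hasGap [Finite A] (h : IsMixing X) {l : ℕ} (hl : 0 < l)
    (hw : HasWindow X l) : ∃ g : ℕ, HasGap X g := by
  choose M hM using fun u v : Words X l =>
    h _ (ofFn_mem_language hl u) _ (ofFn_mem_language hl v)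
  obtain ⟨g, hg⟩ := (Set.finite_range fun p : Words X l × Words X l => M p.1 p.2).bddAbove
  refine ⟨g, fun x y i => ?_⟩
  obtain ⟨w, ⟨hwl, -⟩, hmem⟩ := hM (block l x (i - l)) (block l y (i + g)) g (hg ⟨(_, _), rfl⟩)
  simp only [language, Set.mem_iUnion] at hmem
  obtain ⟨m, -, -, z, hz, hoc⟩ := hmem
  -- The connecting word occurs in z at coordinate 1; this translate puts its first letter at i - l.
  obtain ⟨a, ha⟩ : ∃ a : X.carrier, ∀ t, a.1 t = z (t + (1 + l - i)) :=
    ⟨⟨_, shift_mem hz _⟩, fun _ => rfl⟩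
  have hleft : ∀ t, i - l ≤ t → t < i - l + l → x.1 t = a.1 t := by
    intro t h1 h2
    obtain ⟨s, rfl⟩ : ∃ s : ℕ, t = i - l + s := ⟨(t - (i - l)).toNat, by omega⟩
    have := hoc s (by simp; omega)
    rw [List.getElem_append_left (by simp; omega),
      List.getElem_append_left (by simp; omega)] at this
    rw [ha]
    simp only [List.getElem_ofFn, block] at this
    rw [← this]
    congr 1
    ring
  have hright : ∀ t, i + g ≤ t → t < i + g + l → a.1 t = y.1 t := by
    intro t h1 h2
    obtain ⟨s, rfl⟩ : ∃ s : ℕ, t = i + g + s := ⟨(t - (i + g)).toNat, by omega⟩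
    have := hoc (l + g + s) (by simp; omega)
    rw [List.getElem_append_right (by simp; omega)] at this
    simp only [List.getElem_ofFn, List.length_append, List.length_ofFn, hwl, block,
      Nat.add_sub_cancel_left] at this
    rw [ha, ← this]
    congr 1
    push_cast
    ring
  obtain ⟨b, hb1, hb2⟩ := hw.glue x a (i - l) hleft
  obtain ⟨c, hc1, hc2⟩ := hw.glue b y (i + g) fun t h1 h2 => by
    rw [hb2 t (by omega), hright t h1 h2]
  exact ⟨c, fun t ht => by rw [hc1 t (by omega), hb1 t (by omega)], hc2⟩

/-- Joining a left half, a middle word and a right half. -/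
theorem HasGap.exists_join₃ {g : ℕ} (h : HasGap X g) (x y z : X.carrier) {i j : ℤ}
    (hij : i + g ≤ j) : ∃ u : X.carrier, (∀ t, t < i → u.1 t = x.1 t) ∧
      (∀ t, i + g ≤ t → t < j → u.1 t = y.1 t) ∧ ∀ t, j + g ≤ t → u.1 t = z.1 t := by
  obtain ⟨a, ha1, ha2⟩ := h x y i
  obtain ⟨b, hb1, hb2⟩ := h a z j
  exact ⟨b, fun t ht => by rw [hb1 t (by omega), ha1 t ht],
    fun t h1 h2 => by rw [hb1 t h2, ha2 t h1], hb2⟩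

theorem IsNontrivialMixingSFT.exists_ne_zero (hX : IsNontrivialMixingSFT X) :
    ∃ x y : X.carrier, x.1 0 ≠ y.1 0 := by
  by_contra! hcon
  obtain ⟨x, hx⟩ := hX.nonempty
  have key : ∀ x y : X.carrier, x = y := by
    intro x y
    refine Subtype.ext (funext fun i => ?_)
    simpa [shiftHomeo_zpow_apply] using hcon ((shiftHomeo X ^ i) x) ((shiftHomeo X ^ i) y)
  have : Subsingleton X.carrier := ⟨key⟩
  exact hX.nontrivial ⟨⟨x, hx⟩, Set.eq_univ_of_forall fun y => ⟨0, key _ _⟩, inferInstance⟩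

end Words

end SymbDyn

namespace SymbDyn

open SymbolicDynamics.FullShift (Subshift)

/-! ### Entropy as the growth rate of the number of words -/

section Entropy

variable {A : Type*} [TopologicalSpace A] {X : Subshift A ℤ}

/-- The number of words of length `n`. -/
noncomputable def wordCount (X : Subshift A ℤ) (n : ℕ) : ℕ := Nat.card (Words X n)

theorem wordCount_pos [Finite A] (hX : X.carrier.Nonempty) (n : ℕ) : 0 < wordCount X n := by
  obtain ⟨x, hx⟩ := hX
  have : Nonempty (Words X n) := ⟨block n ⟨x, hx⟩ 0⟩
  exact Nat.card_pos

theorem wordCount_add_le [Finite A] (m n : ℕ) :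
    wordCount X (m + n) ≤ wordCount X m * wordCount X n := by
  rw [wordCount, wordCount, wordCount, ← Nat.card_prod]
  refine Nat.card_le_card_of_injective (fun w =>
    (subword 0 m (by omega) w, subword m n (by omega) w)) fun v w h => ?_
  obtain ⟨x, rfl⟩ := exists_block_eq v 0
  obtain ⟨y, rfl⟩ := exists_block_eq w 0
  simp only [subword_block, Prod.mk.injEq] at h
  obtain ⟨h1, h2⟩ := h
  rw [block_eq_iff] at h1 h2 ⊢
  intro s hs
  by_cases hsm : s < m
  · simpa using h1 s hsm
  · obtain ⟨r, rfl⟩ := Nat.exists_eq_add_of_le (not_lt.1 hsm)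
    simpa using h2 r (by omega)

theorem wordCount_mono [Finite A] {m n : ℕ} (h : m ≤ n) : wordCount X m ≤ wordCount X n := by
  refine Nat.card_le_card_of_surjective (subword 0 m (by omega)) fun w => ?_
  obtain ⟨x, rfl⟩ := exists_block_eq w 0
  exact ⟨block n x 0, by simp [subword_block]⟩

/-- Each word is continued across a gap to either of two letters, placed at coordinate n + g. -/
theorem HasGap.two_mul_wordCount_le [Finite A] {g : ℕ} (h : HasGap X g) {x y : X.carrier}
    (hxy : x.1 0 ≠ y.1 0) (n : ℕ) : 2 * wordCount X n ≤ wordCount X (n + (g + 1)) := by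
  choose z hz1 hz2 using h
  have : 2 * wordCount X n = Nat.card (Words X n × Bool) := by
    simp [wordCount, mul_comm]
  rw [this]
  choose r hr using fun w : Words X n => exists_block_eq w 0
  let a : Bool → X.carrier := fun b => (shiftHomeo X ^ (-(n + g : ℤ))) (if b then x else y)
  have ha : ∀ b, (a b).1 (n + g) = (if b then x else y).1 0 := fun b => by
    rw [shiftHomeo_zpow_apply]; simp
  refine Nat.card_le_card_of_injective
    (fun p => block (n + (g + 1)) (z (r p.1) (a p.2) n) 0) fun p q hpq => ?_
  rw [block_eq_iff] at hpq
  refine Prod.ext ?_ ?_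
  · rw [← hr p.1, ← hr q.1, block_eq_iff]
    intro s hs
    have := hpq s (by omega)
    rwa [hz1 _ _ _ _ (by omega), hz1 _ _ _ _ (by omega)] at this
  · have := hpq (n + g) (by omega)
    rw [hz2 _ _ _ _ (by push_cast; omega), hz2 _ _ _ _ (by push_cast; omega)] at this
    simp only [Nat.cast_add, zero_add, ha] at this
    by_contra hne
    rcases hp : p.2 <;> rcases hq : q.2 <;> simp only [hp, hq] at this hne
    · exact hne trivial
    · exact hxy this.symm
    · exact hxy this
    · exact hne trivial

theorem HasGap.two_pow_le_wordCount [Finite A] {g : ℕ} (h : HasGap X g) {x y : X.carrier}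
    (hxy : x.1 0 ≠ y.1 0) (m : ℕ) : 2 ^ m ≤ wordCount X (m * (g + 1)) := by
  induction m with
  | zero => simpa using Nat.succ_le_of_lt (wordCount_pos ⟨x.1, x.2⟩ 0)
  | succ m ih =>
    calc 2 ^ (m + 1) = 2 * 2 ^ m := by ring
      _ ≤ 2 * wordCount X (m * (g + 1)) := by gcongr
      _ ≤ wordCount X (m * (g + 1) + (g + 1)) := h.two_mul_wordCount_le hxy _
      _ = _ := by rw [add_mul, one_mul]

/-- The pairs of points which agree on all coordinates `t` with `-N ≤ t ≤ N`. -/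
def agreeRel (X : Subshift A ℤ) (N : ℕ) : SetRel X.carrier X.carrier :=
  {p | block (2 * N + 1) p.1 (-N) = block (2 * N + 1) p.2 (-N)}

theorem mem_agreeRel {N : ℕ} {x y : X.carrier} :
    (x, y) ∈ agreeRel X N ↔ ∀ t : ℤ, -N ≤ t → t ≤ N → x.1 t = y.1 t := by
  change block _ _ _ = block _ _ _ ↔ _
  rw [block_eq_iff]
  constructor
  · intro h t h1 h2
    have := h (t + N).toNat (by omega)
    rwa [show -(N : ℤ) + ((t + N).toNat : ℤ) = t by omega] at this
  · intro h s hs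
    exact h _ (by omega) (by omega)

theorem isClopen_agreeRel [DiscreteTopology A] (N : ℕ) : IsClopen (agreeRel X N) := by
  have h : Continuous fun p : X.carrier × X.carrier =>
      (block (2 * N + 1) p.1 (-N), block (2 * N + 1) p.2 (-N)) :=
    ((continuous_block _ _).comp continuous_fst).prodMk
      ((continuous_block _ _).comp continuous_snd)
  exact (isClopen_discrete {q : Words X (2 * N + 1) × Words X (2 * N + 1) | q.1 = q.2}).preimage h

/-- The relations are clopen, decrease with N and intersect in the diagonal; by compactness they are
cofinal among its neighborhoods. -/
theorem hasBasis_agreeRel [Finite A] [DiscreteTopology A] :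
    (@uniformity X.carrier uniformSpaceOfCompactR1).HasBasis (fun _ : ℕ => True)
      (agreeRel X) := by
  refine ⟨fun U => ?_⟩
  change U ∈ nhdsSet (Set.diagonal X.carrier) ↔ _
  constructor
  · intro hU
    have hdir : Directed (· ⊇ ·) (agreeRel X) := by
      refine directed_of_isDirected_le fun M N hMN => ?_
      rintro ⟨x, y⟩ h
      rw [mem_agreeRel] at h ⊢
      exact fun t h1 h2 => h t (by omega) (by omega)
    obtain ⟨N, hN⟩ := exists_subset_nhds_of_isCompact' hdir
      (fun N => (isClopen_agreeRel N).isClosed.isCompact) (fun N => (isClopen_agreeRel N).isClosed)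
      (U := U) (by
        rintro ⟨x, y⟩ h
        have : x = y := by
          refine Subtype.ext (funext fun t => ?_)
          exact mem_agreeRel.1 (Set.mem_iInter.1 h t.natAbs) t (by omega) (by omega)
        subst this
        exact mem_nhdsSet_iff_forall.1 hU (x, x) rfl)
    exact ⟨N, trivial, hN⟩
  · rintro ⟨N, _, hN⟩
    refine Filter.mem_of_superset ((isClopen_agreeRel N).isOpen.mem_nhdsSet.2 ?_) hN
    rintro ⟨x, y⟩ h
    obtain rfl : x = y := h
    exact mem_agreeRel.2 fun _ _ _ => rfl

theorem shiftHomeo_iterate_apply (n : ℕ) (x : X.carrier) (i : ℤ) :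
    ((shiftHomeo X)^[n] x).1 i = x.1 (i + n) := by
  induction n generalizing x with
  | zero => simp
  | succ n ih =>
    rw [Function.iterate_succ_apply, ih]
    simp [shiftHomeo, add_assoc]

open Dynamics in
-- Agreement on [-N, N] along n steps only involves coordinates in [-N, N + n), so one point per
-- word of length 2N + n suffices.
theorem coverMincard_agreeRel_le [Finite A] (N n : ℕ) :
    coverMincard (shiftHomeo X) Set.univ (agreeRel X N) n ≤ wordCount X (2 * N + n) := by
  classical
  have := Fintype.ofFinite (Words X (2 * N + n))
  choose r hr using fun w : Words X (2 * N + n) => exists_block_eq w (-N)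
  have hcov : IsDynCoverOf (shiftHomeo X) Set.univ (agreeRel X N) n
      ((Finset.univ.image r : Finset X.carrier) : Set X.carrier) := by
    intro x _
    refine ⟨r (block _ x (-N)), by simp, mem_dynEntourage.2 fun k hk => mem_agreeRel.2 ?_⟩
    intro t h1 h2
    have h := block_eq_iff.1 (hr (block _ x (-N))) (t + k + N).toNat (by omega)
    rw [show -(N : ℤ) + ((t + k + N).toNat : ℤ) = t + k by omega] at h
    rw [shiftHomeo_iterate_apply, shiftHomeo_iterate_apply, h]
  refine hcov.coverMincard_le_card.trans ?_
  rw [wordCount, Nat.card_eq_fintype_card]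
  exact_mod_cast Finset.card_image_le

open Dynamics in
-- Agreement at coordinate 0 along n steps means having the same word of length n, so every cover
-- must realize all of them.
theorem wordCount_le_coverMincard (n : ℕ) :
    wordCount X n ≤ coverMincard (shiftHomeo X) Set.univ (agreeRel X 0) n := by
  refine le_iInf₂ fun s hs => ?_
  have : Function.Surjective fun x : s => block n x.1 0 := by
    intro w
    obtain ⟨x, rfl⟩ := exists_block_eq w 0
    obtain ⟨y, hy, hxy⟩ := hs (Set.mem_univ x)
    refine ⟨⟨y, hy⟩, block_eq_iff.2 fun k hk => ?_⟩
    have h := mem_agreeRel.1 (mem_dynEntourage.1 hxy k hk) 0 (by simp) (by simp)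
    rw [shiftHomeo_iterate_apply, shiftHomeo_iterate_apply] at h
    exact h.symm
  have := Nat.card_le_card_of_surjective _ this
  rw [Nat.card_eq_finsetCard] at this
  exact_mod_cast this

open Dynamics ExpGrowth in
theorem topEntropy_eq_expGrowthSup [Finite A] [DiscreteTopology A] :
    topEntropy (shiftHomeo X) = expGrowthSup fun n => (wordCount X n : ENNReal) := by
  rw [topEntropy]
  let _ : UniformSpace X.carrier := uniformSpaceOfCompactR1
  rw [coverEntropy_eq_iSup_basis hasBasis_agreeRel]
  apply le_antisymm
  · refine iSup₂_le fun N _ => ?_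
    -- Enlarging N costs at most the factor `wordCount X (2 * N)`, which is constant in n.
    refine expGrowthSup_le_of_eventually_le (b := (wordCount X (2 * N) : ENNReal)) (by simp)
      (Filter.Eventually.of_forall fun n => ?_)
    have h := (coverMincard_agreeRel_le (X := X) N n).trans
      (Nat.cast_le.2 (wordCount_add_le (2 * N) n))
    have := ENat.toENNReal_mono h
    simpa using this
  · refine le_trans ?_ (le_iSup₂ (f := fun (N : ℕ) (_ : True) =>
      coverEntropyEntourage (shiftHomeo X) Set.univ (agreeRel X N)) 0 trivial)
    refine expGrowthSup_monotone fun n => ?_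
    have := ENat.toENNReal_mono (wordCount_le_coverMincard (X := X) n)
    simpa using this

theorem subadditive_log_wordCount [Finite A] (hX : X.carrier.Nonempty) :
    Subadditive fun n => Real.log (wordCount X n) := by
  intro m n
  have h1 : (wordCount X m : ℝ) ≠ 0 := by exact_mod_cast (wordCount_pos hX m).ne'
  have h2 : (wordCount X n : ℝ) ≠ 0 := by exact_mod_cast (wordCount_pos hX n).ne'
  change Real.log _ ≤ Real.log _ + Real.log _
  rw [← Real.log_mul h1 h2]
  refine Real.log_le_log (by exact_mod_cast wordCount_pos hX _) ?_
  exact_mod_cast wordCount_add_le m n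

/-- The topological entropy of a nonempty subshift is the exponential growth rate of the number
of its words. -/
theorem exists_tendsto_log_wordCount [Finite A] [DiscreteTopology A] (hX : X.carrier.Nonempty) :
    ∃ a : ℝ, topEntropy (shiftHomeo X) = (a : EReal) ∧
      Filter.Tendsto (fun n : ℕ => Real.log (wordCount X n) / n) Filter.atTop (nhds a) := by
  have hbdd : BddBelow (Set.range fun n : ℕ => Real.log (wordCount X n) / n) := by
    refine ⟨0, ?_⟩
    rintro _ ⟨n, rfl⟩
    exact div_nonneg (Real.log_natCast_nonneg _) (Nat.cast_nonneg n)
  -- Fekete's lemma.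
  have hlim := (subadditive_log_wordCount hX).tendsto_lim hbdd
  refine ⟨_, ?_, hlim⟩
  rw [topEntropy_eq_expGrowthSup]
  have h2 := (continuous_coe_real_ereal.tendsto _).comp hlim
  refine Filter.Tendsto.limsup_eq (h2.congr fun n => ?_)
  have hpos := wordCount_pos hX n
  simp only [Function.comp_apply, EReal.coe_div]
  rw [ENNReal.log_pos_real (by exact_mod_cast hpos.ne') (by simp)]
  simp

theorem IsNontrivialMixingSFT.exists_entropy [Finite A] [DiscreteTopology A]
    (hX : IsNontrivialMixingSFT X) :
    ∃ a : ℝ, 0 < a ∧ topEntropy (shiftHomeo X) = (a : EReal) ∧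
      Filter.Tendsto (fun n : ℕ => Real.log (wordCount X n) / n) Filter.atTop (nhds a) := by
  obtain ⟨a, ha, hlim⟩ := exists_tendsto_log_wordCount hX.nonempty
  refine ⟨a, ?_, ha, hlim⟩
  obtain ⟨l, hl, hwin⟩ := hX.finiteType.exists_hasWindow
  obtain ⟨g, hg⟩ := hX.mixing.exists_hasGap hl hwin
  obtain ⟨x, y, hxy⟩ := hX.exists_ne_zero
  have hsub : Filter.Tendsto (fun m : ℕ => m * (g + 1)) Filter.atTop Filter.atTop :=
    Filter.tendsto_id.atTop_mul_const' (Nat.succ_pos g)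
  refine lt_of_lt_of_le (b := Real.log 2 / (g + 1)) (by positivity)
    (ge_of_tendsto (hlim.comp hsub) ?_)
  filter_upwards [Filter.eventually_gt_atTop 0] with m hm
  have hm' : (0 : ℝ) < m := by exact_mod_cast hm
  have h : (2 : ℝ) ^ m ≤ wordCount X (m * (g + 1)) := by
    exact_mod_cast hg.two_pow_le_wordCount hxy m
  have h2 := Real.log_le_log (by positivity) h
  rw [Real.log_pow] at h2
  simp only [Function.comp_apply]
  rw [div_le_div_iff₀ (by positivity) (by push_cast; positivity)]
  push_cast
  calc Real.log 2 * (m * (g + 1)) = m * Real.log 2 * (g + 1) := by ring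
    _ ≤ _ := by gcongr

end Entropy

end SymbDyn

namespace SymbDyn

open SymbolicDynamics.FullShift (Subshift)

/-! ### Block automorphisms -/

section BlockAutomorphisms

variable {A : Type*} [TopologicalSpace A] {X : Subshift A ℤ}

/-- The prefix and the suffix of length `l` of a word of length `n + l`. -/
noncomputable def ends (l n : ℕ) (w : Words X (n + l)) : Words X l × Words X l :=
  (subword 0 l (by omega) w, subword n l (by omega) w)

theorem ends_block (l n : ℕ) (x : X.carrier) (i : ℤ) :
    ends l n (block (n + l) x i) = (block l x i, block l x (i + n)) := by
  simp [ends, subword_block]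

/-- The words of length `n + l` with given prefix and suffix of length `l`. -/
abbrev Fiber (X : Subshift A ℤ) (l n : ℕ) (c : Words X l × Words X l) : Type _ :=
  {w : Words X (n + l) // ends l n w = c}

/-- The families of permutations of the words of length `n + l` with given prefix and suffix. -/
abbrev FiberPerm (X : Subshift A ℤ) (l n : ℕ) : Type _ :=
  ∀ c : Words X l × Words X l, Equiv.Perm (Fiber X l n c)

variable {l n : ℕ}

/-- The action of a family of permutations on words. -/
noncomputable def act (b : FiberPerm X l n) (w : Words X (n + l)) : Words X (n + l) :=
  (b (ends l n w) ⟨w, rfl⟩).1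

theorem act_eq (b : FiberPerm X l n) (w : Words X (n + l)) {c} (h : ends l n w = c) :
    act b w = (b c ⟨w, h⟩).1 := by
  subst h
  rfl

theorem ends_act (b : FiberPerm X l n) (w : Words X (n + l)) :
    ends l n (act b w) = ends l n w :=
  (b (ends l n w) ⟨w, rfl⟩).2

theorem act_one (w : Words X (n + l)) : act (1 : FiberPerm X l n) w = w := rfl

theorem act_mul (b b' : FiberPerm X l n) (w : Words X (n + l)) :
    act (b * b') w = act b (act b' w) := by
  rw [act_eq b _ (ends_act b' w)]
  rfl

/-- The value at coordinate `i` of the sequence obtained from `x` by applying the permutations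
to the words at coordinates `[t * n, t * n + n + l)`. -/
noncomputable def blockFun (b : FiberPerm X l n) (x : X.carrier) (i : ℤ) : A :=
  -- For n > 0 the condition always holds; the other branch is a default value.
  if h : (i % n).toNat < n + l then
    (act b (block (n + l) x (i / n * n))).1 ⟨(i % n).toNat, h⟩ else x.1 i

theorem blockFun_of_lt (b : FiberPerm X l n) (x : X.carrier) (t : ℤ) (s : Fin (n + l))
    (hs : (s : ℕ) < n) :
    blockFun b x (t * n + (s : ℕ)) = (act b (block (n + l) x (t * n))).1 s := by
  have hn : (n : ℤ) ≠ 0 := by omega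
  have h1 : (t * n + (s : ℕ) : ℤ) / n = t := by
    rw [Int.add_comm, Int.add_mul_ediv_right _ _ hn, Int.ediv_eq_zero_of_lt] <;> omega
  have h2 : (t * n + (s : ℕ) : ℤ) % n = (s : ℕ) := by
    rw [Int.add_comm, Int.add_mul_emod_self_right, Int.emod_eq_of_lt] <;> omega
  rw [blockFun, dif_pos (by rw [h2]; simp)]
  simp only [h1, h2, Int.toNat_natCast]

theorem act_block_prefix (b : FiberPerm X l n) (x : X.carrier) (i : ℤ) (s : ℕ) (hs : s < l) :
    (act b (block (n + l) x i)).1 ⟨s, by omega⟩ = x.1 (i + s) := by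
  have h := ends_act b (block (n + l) x i)
  obtain ⟨y, hy⟩ := exists_block_eq (act b (block (n + l) x i)) i
  rw [← hy, ends_block, ends_block, Prod.mk.injEq] at h
  rw [← hy]
  exact block_eq_iff.1 h.1 s hs

theorem act_block_suffix (b : FiberPerm X l n) (x : X.carrier) (i : ℤ) (s : ℕ) (hs : s < l) :
    (act b (block (n + l) x i)).1 ⟨n + s, by omega⟩ = x.1 (i + n + s) := by
  have h := ends_act b (block (n + l) x i)
  obtain ⟨y, hy⟩ := exists_block_eq (act b (block (n + l) x i)) i
  rw [← hy, ends_block, ends_block, Prod.mk.injEq] at h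
  rw [← hy, ← block_eq_iff.1 h.2 s hs]
  simp [block, add_assoc]

/-- Consecutive blocks overlap in l letters. There the two prescriptions agree, because both leave
the letters of x unchanged. -/
theorem blockFun_apply (hln : l ≤ n) (b : FiberPerm X l n) (x : X.carrier) (t : ℤ)
    (s : Fin (n + l)) :
    blockFun b x (t * n + (s : ℕ)) = (act b (block (n + l) x (t * n))).1 s := by
  by_cases hs : (s : ℕ) < n
  · exact blockFun_of_lt b x t s hs
  · obtain ⟨s, hs'⟩ := s
    obtain ⟨r, rfl⟩ := Nat.exists_eq_add_of_le (not_lt.1 hs)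
    rw [act_block_suffix b x _ r (by omega)]
    have h := blockFun_of_lt b x (t + 1) ⟨r, by omega⟩ (by simp only; omega)
    rw [act_block_prefix b x _ r (by omega)] at h
    have e : (t * n + ((n + r : ℕ) : ℤ)) = (t + 1) * n + r := by push_cast; ring
    rw [e, h, add_mul, one_mul]

theorem exists_coord (hn : 0 < n) (i : ℤ) : ∃ (t : ℤ) (s : ℕ), s < n ∧ i = t * n + s := by
  refine ⟨i / n, (i % n).toNat, ?_, ?_⟩
  · have := Int.emod_lt_of_pos i (b := n) (by omega)
    omega
  · rw [Int.toNat_of_nonneg (Int.emod_nonneg _ (by omega)), mul_comm, Int.mul_ediv_add_emod]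

variable (hwin : HasWindow X l) (hn : 0 < n) (hln : l ≤ n)
include hwin hn hln

/-- A window of length l + 1 starting in [t n, t n + n) stays inside the single block [t n, t n + n
+ l), which carries a word of X. -/
theorem blockFun_mem (b : FiberPerm X l n) (x : X.carrier) : blockFun b x ∈ X.carrier := by
  refine hwin _ fun i => ?_
  obtain ⟨t, s, hs, rfl⟩ := exists_coord hn i
  obtain ⟨y, hy⟩ := exists_block_eq (act b (block (n + l) x (t * n))) (t * n)
  refine ⟨y, fun u h1 h2 => ?_⟩
  obtain ⟨r, rfl⟩ : ∃ r : ℕ, u = t * n + r := ⟨(u - t * n).toNat, by omega⟩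
  have := blockFun_apply hln b x t ⟨r, by omega⟩
  rw [← hy] at this
  exact this

/-- The block map of a family of permutations, on the points of `X`. -/
noncomputable def blockMap (b : FiberPerm X l n) (x : X.carrier) : X.carrier :=
  ⟨blockFun b x, blockFun_mem hwin hn hln b x⟩

theorem block_blockMap (b : FiberPerm X l n) (x : X.carrier) (t : ℤ) :
    block (n + l) (blockMap hwin hn hln b x) (t * n) = act b (block (n + l) x (t * n)) :=
  Subtype.ext (funext fun s => blockFun_apply hln b x t s)

omit hwin hln in
theorem eq_of_block_eq {x y : X.carrier}
    (h : ∀ t : ℤ, block (n + l) x (t * n) = block (n + l) y (t * n)) : x = y := by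
  refine Subtype.ext (funext fun i => ?_)
  obtain ⟨t, s, hs, rfl⟩ := exists_coord hn i
  exact block_eq_iff.1 (h t) s (by omega)

theorem blockMap_mul (b b' : FiberPerm X l n) (x : X.carrier) :
    blockMap hwin hn hln (b * b') x = blockMap hwin hn hln b (blockMap hwin hn hln b' x) :=
  eq_of_block_eq hn fun t => by
    rw [block_blockMap, block_blockMap, block_blockMap, act_mul]

theorem blockMap_one (x : X.carrier) :
    blockMap hwin hn hln (1 : FiberPerm X l n) x = x :=
  eq_of_block_eq hn fun t => by rw [block_blockMap, act_one]

theorem continuous_blockMap [Finite A] [DiscreteTopology A] (b : FiberPerm X l n) :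
    Continuous (blockMap hwin hn hln b) := by
  refine Continuous.subtype_mk (continuous_pi fun i => ?_) _
  obtain ⟨t, s, hs, rfl⟩ := exists_coord hn i
  have h : Continuous fun x : X.carrier =>
      (act b (block (n + l) x (t * n))).1 ⟨s, by omega⟩ :=
    (continuous_of_discreteTopology (f := fun w : Words X (n + l) =>
      (act b w).1 ⟨s, by omega⟩)).comp (continuous_block _ _)
  exact h.congr fun x => (blockFun_apply hln b x t ⟨s, by omega⟩).symm

/-- The block automorphisms: families of permutations of the words of length `n + l` with given
prefix and suffix of length `l` act on `X`. -/
noncomputable def blockHom [Finite A] [DiscreteTopology A] :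
    FiberPerm X l n →* (X.carrier ≃ₜ X.carrier) where
  toFun b :=
    { toFun := blockMap hwin hn hln b
      invFun := blockMap hwin hn hln b⁻¹
      left_inv := fun x => by rw [← blockMap_mul, inv_mul_cancel, blockMap_one]
      right_inv := fun x => by rw [← blockMap_mul, mul_inv_cancel, blockMap_one]
      continuous_toFun := continuous_blockMap hwin hn hln b
      continuous_invFun := continuous_blockMap hwin hn hln b⁻¹ }
  map_one' := Homeomorph.ext fun x => blockMap_one hwin hn hln x
  map_mul' b b' := Homeomorph.ext fun x => blockMap_mul hwin hn hln b b' x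

omit hwin hn hln in
/-- The maps of `X` that commute with the `n`-th power of the shift, act on the words of length
`n + l` at the origin, and fix the prefix of length `l` of these. -/
structure IsBlockLocal (l n : ℕ) (φ : X.carrier ≃ₜ X.carrier) : Prop where
  comm : Commute (shiftHomeo X ^ n) φ
  local' : ∀ x y, block (n + l) x 0 = block (n + l) y 0 →
    block (n + l) (φ x) 0 = block (n + l) (φ y) 0
  fix : ∀ x, block l (φ x) 0 = block l x 0

omit hwin hn hln in
theorem shift_apply_of_commute {φ : X.carrier ≃ₜ X.carrier} (h : Commute (shiftHomeo X ^ n) φ)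
    (t : ℤ) (x : X.carrier) :
    φ ((shiftHomeo X ^ (t * n)) x) = (shiftHomeo X ^ (t * n)) (φ x) := by
  have := (h.zpow_left t).eq
  rw [← zpow_natCast, ← zpow_mul, mul_comm (n : ℤ)] at this
  exact (DFunLike.congr_fun this x).symm

omit hwin hn hln in
theorem block_apply_of_commute {φ : X.carrier ≃ₜ X.carrier}
    (h : Commute (shiftHomeo X ^ n) φ) (N : ℕ) (x : X.carrier) (t : ℤ) :
    block N (φ x) (t * n) = block N (φ ((shiftHomeo X ^ (t * n)) x)) 0 := by
  rw [shift_apply_of_commute h, block_shift, zero_add]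

theorem isBlockLocal_blockHom [Finite A] [DiscreteTopology A] (b : FiberPerm X l n) :
    IsBlockLocal l n (blockHom hwin hn hln b) := by
  have key : ∀ x t, block (n + l) (blockHom hwin hn hln b x) (t * n) =
    act b (block (n + l) x (t * n)) := block_blockMap hwin hn hln b
  refine ⟨?_, fun x y h => ?_, fun x => ?_⟩
  · refine Homeomorph.ext fun x => eq_of_block_eq (l := l) hn fun t => ?_
    simp only [Homeomorph.mul_apply, ← zpow_natCast]
    have e : t * (n : ℤ) + n = (t + 1) * n := by ring
    rw [block_shift, key, block_shift, e, key]
  · have h1 := key x 0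
    have h2 := key y 0
    rw [zero_mul] at h1 h2
    rw [h1, h2, h]
  · have h1 := congrArg (subword 0 l (by omega)) (key x 0)
    have h2 := congrArg Prod.fst (ends_act b (block (n + l) x (0 * n)))
    have h3 := h1.trans h2
    simpa [ends, subword_block] using h3

omit hwin hln in
-- The long block is covered by m short overlapping ones, on each of which φ acts separately.
theorem IsBlockLocal.mul_right {φ : X.carrier ≃ₜ X.carrier} (h : IsBlockLocal l n φ) (m : ℕ)
    (hm : 0 < m) : IsBlockLocal l (n * m) φ := by
  refine ⟨?_, fun x y hxy => ?_, h.fix⟩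
  · rw [pow_mul]
    exact h.comm.pow_left m
  · rw [block_eq_iff] at hxy ⊢
    have key : ∀ t : ℕ, t < m → block (n + l) (φ x) (t * n) = block (n + l) (φ y) (t * n) := by
      intro t ht
      rw [block_apply_of_commute h.comm, block_apply_of_commute h.comm]
      apply h.local'
      rw [block_shift, block_shift, block_eq_iff]
      intro s hs
      have hle : (t + 1) * n ≤ m * n := Nat.mul_le_mul_right n ht
      have := hxy (t * n + s) (by rw [mul_comm n m]; rw [add_mul, one_mul] at hle; omega)
      push_cast at this
      simpa [add_assoc] using this
    intro s hs
    by_cases hsn : s < n * m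
    · have hd : s / n < m := Nat.div_lt_of_lt_mul hsn
      have hr : s % n < n := Nat.mod_lt _ hn
      have := block_eq_iff.1 (key (s / n) hd) (s % n) (by omega)
      have e : ((s / n : ℕ) : ℤ) * n + (s % n : ℕ) = 0 + s := by
        rw [zero_add, mul_comm]
        exact_mod_cast Nat.div_add_mod s n
      rwa [e] at this
    · obtain ⟨r, rfl⟩ := Nat.exists_eq_add_of_le (not_lt.1 hsn)
      obtain ⟨m, rfl⟩ := Nat.exists_eq_succ_of_ne_zero hm.ne'
      have := block_eq_iff.1 (key m (by omega)) (n + r) (by omega)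
      have e : (m : ℤ) * n + ((n + r : ℕ) : ℤ) = 0 + ((n * m.succ + r : ℕ) : ℤ) := by
        push_cast
        ring
      rwa [e] at this

/-- The suffix of a block is the prefix of the next one, so it is fixed too; locality of the inverse
makes the induced map on words a permutation of each fiber. This intrinsic description is what
allows a change of level. -/
theorem IsBlockLocal.mem_range_blockHom [Finite A] [DiscreteTopology A]
    {φ : X.carrier ≃ₜ X.carrier} (h : IsBlockLocal l n φ) (h' : IsBlockLocal l n φ⁻¹) :
    ∃ b, blockHom hwin hn hln b = φ := by
  choose r hr using fun w : Words X (n + l) => exists_block_eq w 0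
  have hends : ∀ {ψ : X.carrier ≃ₜ X.carrier}, IsBlockLocal l n ψ → ∀ w,
      ends l n (block (n + l) (ψ (r w)) 0) = ends l n w := by
    intro ψ hψ w
    have h1 := block_apply_of_commute hψ.comm l (r w) 1
    rw [hψ.fix, block_shift] at h1
    rw [ends_block, hψ.fix]
    conv_rhs => rw [← hr w, ends_block]
    simpa using h1
  have hinv : ∀ {ψ χ : X.carrier ≃ₜ X.carrier}, IsBlockLocal l n ψ → (∀ x, ψ (χ x) = x) →
      ∀ w, block (n + l) (ψ (r (block (n + l) (χ (r w)) 0))) 0 = w := by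
    intro ψ χ hψ hχ w
    rw [hψ.local' _ (χ (r w)) (hr _), hχ, hr]
  let b : FiberPerm X l n := fun c =>
    { toFun := fun w => ⟨block (n + l) (φ (r w.1)) 0, (hends h w.1).trans w.2⟩
      invFun := fun w => ⟨block (n + l) (φ⁻¹ (r w.1)) 0, (hends h' w.1).trans w.2⟩
      left_inv := fun w => Subtype.ext (hinv h' (fun x => φ.symm_apply_apply x) w.1)
      right_inv := fun w => Subtype.ext (hinv h (fun x => φ.apply_symm_apply x) w.1) }
  refine ⟨b, Homeomorph.ext fun x => eq_of_block_eq (l := l) hn fun t => ?_⟩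
  refine (block_blockMap hwin hn hln b x t).trans ?_
  rw [block_apply_of_commute h.comm]
  change block (n + l) (φ (r (block (n + l) x (t * n)))) 0 = _
  apply h.local'
  rw [hr, block_shift, zero_add]

/-- Block automorphisms of level `n` are block automorphisms of level `n * m`. -/
theorem exists_blockHom_mul_eq [Finite A] [DiscreteTopology A] {m : ℕ} (hm : 0 < m)
    (hnm : 0 < n * m) (hlnm : l ≤ n * m) (b : FiberPerm X l n) :
    ∃ b' : FiberPerm X l (n * m), blockHom hwin hnm hlnm b' = blockHom hwin hn hln b := by
  refine ((isBlockLocal_blockHom hwin hn hln b).mul_right hn m hm).mem_range_blockHom hwin hnm hlnm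
    ?_
  rw [← map_inv]
  exact (isBlockLocal_blockHom hwin hn hln b⁻¹).mul_right hn m hm

theorem blockHom_injective [Finite A] [DiscreteTopology A] :
    Function.Injective (blockHom (X := X) hwin hn hln) := by
  refine (injective_iff_map_eq_one _).2 fun b hb => funext fun c => Equiv.ext fun w => ?_
  obtain ⟨x, hx⟩ := exists_block_eq w.1 (0 * n)
  refine Subtype.ext ?_
  have h := block_blockMap hwin hn hln b x 0
  have h1 : blockMap hwin hn hln b x = x := DFunLike.congr_fun hb x
  rw [h1, hx, act_eq b _ w.2] at h
  exact h.symm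

omit hwin hln hn in
/-- Lower bound for the number of words with given prefix and suffix. -/
theorem HasGap.wordCount_le_card_fiber [Finite A] {g N : ℕ} (h : HasGap X g)
    (hN : l + g + N + g = n) (c : Words X l × Words X l) :
    wordCount X N ≤ Nat.card (Fiber X l n c) := by
  subst hN
  obtain ⟨c₁, c₂⟩ := c
  obtain ⟨x, rfl⟩ := exists_block_eq c₁ 0
  obtain ⟨y, rfl⟩ := exists_block_eq c₂ ((l + g + N + g : ℕ) : ℤ)
  choose r hr using fun w : Words X N => exists_block_eq w (l + g)
  choose u hu1 hu2 hu3 using fun w : Words X N =>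
    h.exists_join₃ x (r w) y (i := l) (j := l + g + N) (by omega)
  refine Nat.card_le_card_of_injective (fun w => ⟨block _ (u w) 0, ?_⟩) fun v w hvw => ?_
  · rw [ends_block, Prod.mk.injEq, block_eq_iff, block_eq_iff]
    refine ⟨fun s hs => hu1 w _ (by omega), fun s hs => ?_⟩
    rw [hu3 w _ (by push_cast; omega), zero_add]
  · have h1 := block_eq_iff.1 (congrArg Subtype.val hvw)
    rw [← hr v, ← hr w, block_eq_iff]
    intro s hs
    have := h1 (l + g + s) (by omega)
    rw [hu2 v _ (by push_cast; omega) (by push_cast; omega),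
      hu2 w _ (by push_cast; omega) (by push_cast; omega)] at this
    simpa [add_assoc] using this

end BlockAutomorphisms

end SymbDyn

namespace SymbDyn

open SymbolicDynamics.FullShift (Subshift)

/-! ### Finite permutation groups -/

section PermutationGroups

/-- Otherwise |E|!/2 ≤ |F|! ≤ (|E| - 1)!, which forces |E| ≤ 2. -/
theorem card_le_of_alternatingGroup_injective {E F : Type*} [Fintype E] [DecidableEq E] [Finite F]
    (hE : 5 ≤ Nat.card E) (f : alternatingGroup E →* Equiv.Perm F) (hf : Function.Injective f) :
    Nat.card E ≤ Nat.card F := by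
  by_contra! hlt
  have : Nontrivial E := Finite.one_lt_card_iff_nontrivial.1 (by omega)
  have h1 := Nat.card_le_card_of_injective f hf
  have h2 := two_mul_nat_card_alternatingGroup (α := E)
  rw [Nat.card_perm] at h1 h2
  obtain ⟨N, hN⟩ := Nat.exists_eq_succ_of_ne_zero (show Nat.card E ≠ 0 by omega)
  rw [hN, Nat.factorial_succ] at h2
  have h3 : (Nat.card F).factorial ≤ N.factorial := Nat.factorial_le (by omega)
  have h4 := N.factorial_pos
  have h5 : 5 * N.factorial ≤ (N + 1) * N.factorial := Nat.mul_le_mul_right _ (by omega)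
  omega

/-- If a product of large symmetric groups acts on a finite set and some square acts nontrivially,
then the set is at least as large as one of the sets on which the factors act. -/
theorem exists_card_le_of_map_mul_self_ne_one {I : Type*} [Finite I] {E : I → Type*}
    [∀ i, Finite (E i)] (hE : ∀ i, 5 ≤ Nat.card (E i)) {F : Type*} [Finite F]
    (f : (∀ i, Equiv.Perm (E i)) →* Equiv.Perm F) (b : ∀ i, Equiv.Perm (E i))
    (hb : f (b * b) ≠ 1) : ∃ i, Nat.card (E i) ≤ Nat.card F := by
  classical
  have := fun i => Fintype.ofFinite (E i)
  by_contra! hlt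
  have hle : Subgroup.pi Set.univ (fun i => alternatingGroup (E i)) ≤ f.ker := by
    refine Subgroup.pi_le_iff.2 fun i => ?_
    rintro _ ⟨a, ha, rfl⟩
    let q : alternatingGroup (E i) →* Equiv.Perm F :=
      (f.comp (MonoidHom.mulSingle _ i)).comp (alternatingGroup (E i)).subtype
    have := alternatingGroup.isSimpleGroup (hE i)
    -- By simplicity the alternating group of each factor either embeds, which `hlt` excludes, or
    -- acts trivially.
    rcases (inferInstance : q.ker.Normal).eq_bot_or_eq_top with h | h
    · exact absurd (card_le_of_alternatingGroup_injective (hE i) q ((MonoidHom.ker_eq_bot_iff q).1 h))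
        (not_le.2 (hlt i))
    · have : (⟨a, ha⟩ : alternatingGroup (E i)) ∈ q.ker := h ▸ Subgroup.mem_top _
      exact this
  -- Every component of a square is an even permutation.
  refine hb (hle ?_)
  intro i _
  change _ ∈ alternatingGroup (E i)
  rw [Equiv.Perm.mem_alternatingGroup, Pi.mul_apply, map_mul]
  exact Int.units_mul_self _

theorem exists_perm_mul_self_ne_one {E : Type*} [Finite E] (hE : 5 ≤ Nat.card E) :
    ∃ e : Equiv.Perm E, e * e ≠ 1 := by
  classical
  have := Fintype.ofFinite E
  obtain ⟨a, b, c, hab, hac, hbc⟩ := Fintype.two_lt_card_iff.1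
    (show 2 < Fintype.card E by rw [← Nat.card_eq_fintype_card]; omega)
  refine ⟨Equiv.swap a b * Equiv.swap a c, fun h => ?_⟩
  have := (Equiv.Perm.isThreeCycle_swap_mul_swap_same hab hac hbc).isThreeCycle_sq
  rw [h] at this
  simpa using this.orderOf

end PermutationGroups

/-! ### Periodic points -/

section PeriodicPoints

variable {X : Type*} [TopologicalSpace X]

/-- The action of the automorphisms of `(X, T)` on the fixed points of `T`. -/
def fixHom (T : X ≃ₜ X) : autGroup T →* Equiv.Perm {x : X // T x = x} where
  toFun φ := Equiv.Perm.subtypePerm φ.1.toEquiv fun x => by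
    have h : T (φ.1 x) = φ.1 (T x) := DFunLike.congr_fun (mem_autGroup.1 φ.2).eq x
    change T (φ.1 x) = φ.1 x ↔ _
    rw [h, φ.1.injective.eq_iff]
  map_one' := rfl
  map_mul' _ _ := rfl

theorem zpow_apply_eq_self {T : X ≃ₜ X} {x : X} (h : T x = x) (n : ℤ) : (T ^ n) x = x := by
  have hpow : ∀ m : ℕ, (T ^ m) x = x := by
    intro m
    induction m with
    | zero => rfl
    | succ m ih => rw [pow_succ, Homeomorph.mul_apply, h, ih]
  obtain ⟨m, rfl | rfl⟩ := n.eq_nat_or_neg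
  · rw [zpow_natCast, hpow]
  · conv_lhs => rw [← hpow m]
    rw [← Homeomorph.mul_apply, zpow_neg, zpow_natCast, inv_mul_cancel, Homeomorph.one_apply]

theorem mem_stabAutGroup {T φ : X ≃ₜ X} :
    φ ∈ stabAutGroup T ↔ ∃ n : ℕ, 1 ≤ n ∧ Commute (T ^ n) φ := by
  change φ ∈ ⋃ n ∈ Set.Ici (1 : ℕ), (autGroup (T ^ n) : Set (X ≃ₜ X)) ↔ _
  simp [mem_autGroup]

end PeriodicPoints

section SubshiftPeriodicPoints

variable {A : Type*} [TopologicalSpace A] {X : Subshift A ℤ}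

theorem block_fixedPoint_injective {n : ℕ} (hn : 0 < n) : Function.Injective
    fun x : {x : X.carrier // (shiftHomeo X ^ n) x = x} => block n x.1 0 := by
  intro x y h
  refine Subtype.ext (eq_of_block_eq (l := 0) hn fun t => ?_)
  have key : ∀ x : {x : X.carrier // (shiftHomeo X ^ n) x = x},
      (shiftHomeo X ^ (t * (n : ℤ))) x.1 = x.1 := by
    rintro ⟨x, hx⟩
    have := zpow_apply_eq_self hx t
    rwa [← zpow_natCast, ← zpow_mul, mul_comm] at this
  have h' := h
  simp only at h'
  rw [← key x, ← key y, block_shift, block_shift, block_eq_iff] at h'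
  rw [block_eq_iff]
  simpa using h'

instance [Finite A] (n : ℕ) [NeZero n] :
    Finite {x : X.carrier // (shiftHomeo X ^ n) x = x} :=
  Finite.of_injective _ (block_fixedPoint_injective (NeZero.pos n))

theorem card_fixedPoint_le [Finite A] {n : ℕ} (hn : 0 < n) :
    Nat.card {x : X.carrier // (shiftHomeo X ^ n) x = x} ≤ wordCount X n :=
  Nat.card_le_card_of_injective _ (block_fixedPoint_injective hn)

/-- A point z is built that follows y and then, after a gap, its translate by P. It repeats itself
over a length l, so continuing it periodically creates no new window. -/
theorem HasWindow.exists_periodic {l g : ℕ} (hwin : HasWindow X l) (hgap : HasGap X g)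
    (y : X.carrier) (N : ℕ) : ∃ P : ℕ, 0 < P ∧ ∃ z : X.carrier, (shiftHomeo X ^ P) z = z ∧
      ∀ t : ℤ, -N ≤ t → t ≤ N → z.1 t = y.1 t := by
  -- Chosen so that L + P = N + 1 + g, where z starts to copy the translate of y; hence z on [L + P,
  -- L + P + l) repeats z on [L, L + l).
  obtain ⟨P, hP⟩ : ∃ P : ℕ, P = N + l + 1 + g + N := ⟨_, rfl⟩
  obtain ⟨L, hL⟩ : ∃ L : ℤ, L = -N - l := ⟨_, rfl⟩
  obtain ⟨z, hz1, hz2⟩ := hgap y ((shiftHomeo X ^ (-P : ℤ)) y) (N + 1)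
  have hper : ∀ u, L ≤ u → u < L + P + l → z.1 (L + (u - L) % P) = z.1 u := by
    intro u h1 h2
    by_cases hu : u < L + P
    · rw [Int.emod_eq_of_lt (by omega) (by omega), add_sub_cancel]
    · have e : (u - L) % P = u - L - P := by
        rw [← Int.sub_emod_right, Int.emod_eq_of_lt (by omega) (by omega)]
      rw [e, hz2 u (by omega), shiftHomeo_zpow_apply, show L + (u - L - P) = u + -P by omega]
      exact hz1 _ (by omega)
  refine ⟨P, by omega, ⟨fun t => z.1 (L + (t - L) % P), hwin _ fun i => ?_⟩, ?_, fun t h1 h2 => ?_⟩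
  -- Translating by a multiple of P moves the start of the window into [L, L + P), so the whole
  -- window lies in the range of `hper`.
  · refine ⟨(shiftHomeo X ^ (-((i - L) / P * P))) z, fun t h1 h2 => ?_⟩
    have hd := Int.mul_ediv_add_emod (i - L) P
    have hr := Int.emod_nonneg (i - L) (b := P) (by omega)
    have hr' := Int.emod_lt_of_pos (i - L) (b := P) (by omega)
    rw [mul_comm] at hd
    rw [shiftHomeo_zpow_apply, ← hper (t + -((i - L) / P * P)) (by omega) (by omega),
      show t + -((i - L) / P * P) - L = (t - L) + -((i - L) / P) * P by ring,
      Int.add_mul_emod_self_right]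
  · refine Subtype.ext (funext fun t => ?_)
    rw [shiftHomeo_pow_apply]
    simp only
    rw [show t + P - L = t - L + P by ring, Int.add_emod_right]
  · simp only
    rw [hper t (by omega) (by omega), hz1 t (by omega)]

theorem HasWindow.exists_periodic_ne [Finite A] [DiscreteTopology A] {l g : ℕ}
    (hwin : HasWindow X l) (hgap : HasGap X g) {ψ : X.carrier ≃ₜ X.carrier} (hψ : ψ ≠ 1) :
    ∃ P : ℕ, 0 < P ∧ ∃ z : X.carrier, (shiftHomeo X ^ P) z = z ∧ ψ z ≠ z := by
  obtain ⟨y, hy⟩ : ∃ y, ψ y ≠ y := by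
    by_contra! h
    exact hψ (Homeomorph.ext h)
  have hopen : {y | ψ y ≠ y} ∈ nhds y :=
    (isOpen_ne_fun ψ.continuous continuous_id).mem_nhds hy
  let _ : UniformSpace X.carrier := uniformSpaceOfCompactR1
  have hbasis := nhds_basis_uniformity (hasBasis_agreeRel (X := X)) (x := y)
  obtain ⟨N, -, hN⟩ := hbasis.mem_iff.1 hopen
  obtain ⟨P, hP, z, hz, hzy⟩ := hwin.exists_periodic hgap y N
  exact ⟨P, hP, z, hz, hN (mem_agreeRel.2 hzy)⟩

end SubshiftPeriodicPoints

/-! ### Comparison of entropies -/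

section EntropyComparison

variable {A B : Type*} [Finite A] [TopologicalSpace A] [DiscreteTopology A]
  [Finite B] [TopologicalSpace B] [DiscreteTopology B]
  {X : Subshift A ℤ} {Y : Subshift B ℤ}

theorem exists_wordCount_le (hX : IsNontrivialMixingSFT X) (hY : IsNontrivialMixingSFT Y)
    {K J : ℕ} (hK : 0 < K) (hJ : 0 < J)
    (Φ : stabAutGroup (shiftHomeo X) →* stabAutGroup (shiftHomeo Y)) (hΦ : Function.Injective Φ)
    (hlev : ∀ φ (n : ℕ), Commute (shiftHomeo X ^ (K * n)) φ.1 →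
      Commute (shiftHomeo Y ^ (J * n)) (Φ φ).1) :
    ∃ C D : ℕ, 0 < D ∧ ∀ m : ℕ, 0 < m →
      wordCount X (K * D * m) ≤ wordCount X C * wordCount Y (J * D * m) := by
  classical
  obtain ⟨l, hl, hwin⟩ := hX.finiteType.exists_hasWindow
  obtain ⟨g, hgap⟩ := hX.mixing.exists_hasGap hl hwin
  obtain ⟨l', hl', hwin'⟩ := hY.finiteType.exists_hasWindow
  obtain ⟨g', hgap'⟩ := hY.mixing.exists_hasGap hl' hwin'
  obtain ⟨x, y, hxy⟩ := hX.exists_ne_zero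
  -- Room for a prefix, two gaps and a middle word of length 3(g + 1), which has at least 2³ ≥ 5
  -- values.
  obtain ⟨n₀, hn₀⟩ : ∃ n₀, n₀ = l + g + 3 * (g + 1) + g := ⟨_, rfl⟩
  have hfiber : ∀ n, n₀ ≤ n → ∀ c, 5 ≤ Nat.card (Fiber X l n c) := by
    intro n hn c
    obtain ⟨N, hN⟩ := Nat.exists_eq_add_of_le hn
    have h1 := hgap.two_pow_le_wordCount hxy 3
    have h2 : wordCount X (3 * (g + 1)) ≤ wordCount X (3 * (g + 1) + N) :=
      wordCount_mono (by omega)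
    have h3 := hgap.wordCount_le_card_fiber (l := l) (n := n) (N := 3 * (g + 1) + N) (by omega) c
    omega
  have hKn : n₀ ≤ K * n₀ := Nat.le_mul_of_pos_left _ hK
  have hn : 0 < K * n₀ := by omega
  have hln : l ≤ K * n₀ := by omega
  obtain ⟨b, hb⟩ : ∃ b : FiberPerm X l (K * n₀), b * b ≠ 1 := by
    let c : Words X l × Words X l := (block l x 0, block l x 0)
    obtain ⟨e, he⟩ := exists_perm_mul_self_ne_one (hfiber _ hKn c)
    refine ⟨Pi.mulSingle c e, fun h => he ?_⟩
    simpa using congrFun h c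
  have hstab : ∀ {n : ℕ} (hn : 0 < n) (hln : l ≤ n) (b : FiberPerm X l n),
      blockHom hwin hn hln b ∈ stabAutGroup (shiftHomeo X) := fun hn hln b =>
    mem_stabAutGroup.2 ⟨_, hn, (isBlockLocal_blockHom hwin hn hln b).comm⟩
  let θ : ∀ {n : ℕ} (hn : 0 < n) (hln : l ≤ n), FiberPerm X l n →* stabAutGroup (shiftHomeo X) :=
    fun hn hln => (blockHom hwin hn hln).codRestrict _ (hstab hn hln)
  have hne : (Φ (θ hn hln (b * b))).1 ≠ 1 := by
    intro h
    have h1 : Φ (θ hn hln (b * b)) = 1 := Subtype.ext h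
    rw [map_eq_one_iff Φ hΦ] at h1
    refine hb (blockHom_injective hwin hn hln ?_)
    rw [map_one]
    exact congrArg Subtype.val h1
  obtain ⟨P, hP, z, hz, hzne⟩ := hwin'.exists_periodic_ne hgap' hne
  -- C counts the letters lost to the prefix and the two gaps. With D = n₀ P, every level K D m is a
  -- multiple of K n₀, so b survives, and J D m is a multiple of P, so z stays among the fixed
  -- points.
  refine ⟨l + g + g, n₀ * P, Nat.mul_pos (by omega) hP, fun m hm => ?_⟩
  have hPm : 0 < P * m := Nat.mul_pos hP hm
  have hn' : 0 < K * n₀ * (P * m) := Nat.mul_pos hn hPm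
  have hle' : K * n₀ ≤ K * n₀ * (P * m) := Nat.le_mul_of_pos_right _ hPm
  have hln' : l ≤ K * n₀ * (P * m) := hln.trans hle'
  have hJn : 0 < J * (n₀ * (P * m)) := Nat.mul_pos hJ (Nat.mul_pos (by omega) hPm)
  obtain ⟨b', hb'⟩ := exists_blockHom_mul_eq hwin hn hln hPm hn' hln' b
  have hθ : θ hn' hln' b' = θ hn hln b := Subtype.ext hb'
  have haut : ∀ b : FiberPerm X l (K * n₀ * (P * m)),
      (Φ (θ hn' hln' b)).1 ∈ autGroup (shiftHomeo Y ^ (J * (n₀ * (P * m)))) := by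
    intro b
    refine mem_autGroup.2 (hlev _ _ ?_)
    rw [← mul_assoc]
    exact (isBlockLocal_blockHom hwin hn' hln' b).comm
  let f : FiberPerm X l (K * n₀ * (P * m)) →*
      Equiv.Perm {y : Y.carrier // (shiftHomeo Y ^ (J * (n₀ * (P * m)))) y = y} :=
    (fixHom _).comp ((((stabAutGroup (shiftHomeo Y)).subtype.comp Φ).comp
      (θ hn' hln')).codRestrict _ haut)
  have hzfix : (shiftHomeo Y ^ (J * (n₀ * (P * m)))) z = z := by
    have := zpow_apply_eq_self hz ((J * n₀ * m : ℕ) : ℤ)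
    rwa [zpow_natCast, ← pow_mul, show P * (J * n₀ * m) = J * (n₀ * (P * m)) by ring] at this
  have hf : f (b' * b') ≠ 1 := by
    intro h
    have h1 : (Φ (θ hn' hln' (b' * b'))).1 z = z :=
      congrArg Subtype.val (DFunLike.congr_fun h (⟨z, hzfix⟩ :
        {y : Y.carrier // (shiftHomeo Y ^ (J * (n₀ * (P * m)))) y = y}))
    rw [map_mul, hθ, ← map_mul] at h1
    exact hzne h1
  have : NeZero (J * (n₀ * (P * m))) := ⟨hJn.ne'⟩
  obtain ⟨c, hc⟩ := exists_card_le_of_map_mul_self_ne_one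
    (hfiber _ (hKn.trans hle')) f b' hf
  -- N is the length of the free middle part; submultiplicativity then restores the full length at
  -- the cost of the factor `wordCount X C`.
  obtain ⟨N, hN⟩ := Nat.exists_eq_add_of_le (show l + g + g ≤ K * n₀ * (P * m) by omega)
  have h1 := hgap.wordCount_le_card_fiber (l := l) (n := K * n₀ * (P * m)) (N := N) (by omega) c
  have h2 := card_fixedPoint_le (X := Y) hJn
  rw [show K * (n₀ * P) * m = l + g + g + N by rw [← hN]; ring,
    show J * (n₀ * P) * m = J * (n₀ * (P * m)) by ring]
  exact (wordCount_add_le _ _).trans (Nat.mul_le_mul_left _ (h1.trans (hc.trans h2)))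

omit [Finite A] [DiscreteTopology A] in
theorem tendsto_log_wordCount_mul {a : ℝ}
    (ha : Filter.Tendsto (fun n : ℕ => Real.log (wordCount X n) / n) Filter.atTop (nhds a))
    {K : ℕ} (hK : 0 < K) :
    Filter.Tendsto (fun m : ℕ => Real.log (wordCount X (K * m)) / m) Filter.atTop
      (nhds (K * a)) := by
  have hsub : Filter.Tendsto (fun m : ℕ => K * m) Filter.atTop Filter.atTop :=
    Filter.tendsto_id.const_mul_atTop' hK
  refine ((ha.comp hsub).const_mul (K : ℝ)).congr fun m => ?_
  have hK' : (K : ℝ) ≠ 0 := by exact_mod_cast hK.ne'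
  simp only [Function.comp_apply, Nat.cast_mul]
  rw [mul_div_assoc', mul_div_mul_left _ _ hK']

theorem mul_entropy_le (hX : IsNontrivialMixingSFT X) (hY : IsNontrivialMixingSFT Y)
    {K J : ℕ} (hK : 0 < K) (hJ : 0 < J)
    (Φ : stabAutGroup (shiftHomeo X) →* stabAutGroup (shiftHomeo Y)) (hΦ : Function.Injective Φ)
    (hlev : ∀ φ (n : ℕ), Commute (shiftHomeo X ^ (K * n)) φ.1 →
      Commute (shiftHomeo Y ^ (J * n)) (Φ φ).1) {a b : ℝ}
    (ha : Filter.Tendsto (fun n : ℕ => Real.log (wordCount X n) / n) Filter.atTop (nhds a))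
    (hb : Filter.Tendsto (fun n : ℕ => Real.log (wordCount Y n) / n) Filter.atTop (nhds b)) :
    K * a ≤ J * b := by
  obtain ⟨C, D, hD, h⟩ := exists_wordCount_le hX hY hK hJ Φ hΦ hlev
  have h1 := tendsto_log_wordCount_mul ha (Nat.mul_pos hK hD)
  have h2 := tendsto_log_wordCount_mul hb (Nat.mul_pos hJ hD)
  -- The constant factor disappears after dividing its logarithm by m.
  have h3 := (tendsto_const_div_atTop_nhds_zero_nat (Real.log (wordCount X C))).add h2
  have h4 := le_of_tendsto_of_tendsto h1 h3 (by
    filter_upwards [Filter.eventually_gt_atTop 0] with m hm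
    have hpos : ∀ n, (0 : ℝ) < wordCount X n := fun n => by
      exact_mod_cast wordCount_pos hX.nonempty n
    have hpos' : ∀ n, (0 : ℝ) < wordCount Y n := fun n => by
      exact_mod_cast wordCount_pos hY.nonempty n
    rw [← add_div, ← Real.log_mul (hpos _).ne' (hpos' _).ne']
    gcongr
    · exact hpos _
    · exact_mod_cast h m hm)
  have hD' : (0 : ℝ) < D := by exact_mod_cast hD
  push_cast at h4
  nlinarith

/-- Centralizers do not see the sign of the exponent; this is why only |k| and |j| enter. -/
theorem commute_zpow_iff_pow_natAbs {G : Type*} [Group G] (g h : G) (k : ℤ) (n : ℕ) :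
    Commute ((g ^ k) ^ n) h ↔ Commute (g ^ (k.natAbs * n)) h := by
  obtain ⟨m, rfl | rfl⟩ := k.eq_nat_or_neg <;> simp [pow_mul, Commute.inv_left_iff]

omit [Finite A] [DiscreteTopology A] [Finite B] [DiscreteTopology B] in
/-- An isomorphism of stabilized automorphism groups taking one power of the shift to another
maps the automorphisms of a power to those of the corresponding power. -/
theorem commute_map_of_map_level
    {k j : ℤ} (Φ : stabAutGroup (shiftHomeo X) →* stabAutGroup (shiftHomeo Y))
    (hlevel : Φ (stabSelf (shiftHomeo X) ^ k) = stabSelf (shiftHomeo Y) ^ j)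
    (φ : stabAutGroup (shiftHomeo X)) (n : ℕ)
    (h : Commute (shiftHomeo X ^ (k.natAbs * n)) φ.1) :
    Commute (shiftHomeo Y ^ (j.natAbs * n)) (Φ φ).1 := by
  have h1 : Commute (stabSelf (shiftHomeo X) ^ (k.natAbs * n)) φ := Subtype.ext h.eq
  rw [← commute_zpow_iff_pow_natAbs] at h1
  have h2 := h1.map Φ
  rw [map_pow, hlevel, commute_zpow_iff_pow_natAbs] at h2
  exact congrArg Subtype.val h2.eq

end EntropyComparison

end SymbDyn

theorem mainTheorem5
    {A B : Type*}
    [Finite A] [TopologicalSpace A] [DiscreteTopology A]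
    [Finite B] [TopologicalSpace B] [DiscreteTopology B]
    (X : SymbolicDynamics.FullShift.Subshift A ℤ) (Y : SymbolicDynamics.FullShift.Subshift B ℤ)
    (hX : SymbDyn.IsNontrivialMixingSFT X) (hY : SymbDyn.IsNontrivialMixingSFT Y)
    (k j : ℤ) (hk : k ≠ 0) (hj : j ≠ 0)
    (Φ : SymbDyn.LeveledGroup.Iso
      (SymbDyn.leveledStabAut X hX k hk) (SymbDyn.leveledStabAut Y hY j hj)) :
    ∃ a b : ℝ, 0 < a ∧ 0 < b ∧
      SymbDyn.topEntropy (SymbDyn.shiftHomeo X) = (a : EReal) ∧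
      SymbDyn.topEntropy (SymbDyn.shiftHomeo Y) = (b : EReal) ∧
      a / b = (|j| : ℝ) / (|k| : ℝ) ∧
      ∃ q : ℚ, a / b = (q : ℝ) := by
  obtain ⟨a, ha, hXa, hlima⟩ := hX.exists_entropy
  obtain ⟨b, hb, hYb, hlimb⟩ := hY.exists_entropy
  let Ψ : SymbDyn.stabAutGroup (SymbDyn.shiftHomeo X) ≃*
    SymbDyn.stabAutGroup (SymbDyn.shiftHomeo Y) := Φ.toMulEquiv
  have hlevel : Ψ (SymbDyn.stabSelf (SymbDyn.shiftHomeo X) ^ k) =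
    SymbDyn.stabSelf (SymbDyn.shiftHomeo Y) ^ j := Φ.map_level
  have hlevel' : Ψ.symm (SymbDyn.stabSelf (SymbDyn.shiftHomeo Y) ^ j) =
    SymbDyn.stabSelf (SymbDyn.shiftHomeo X) ^ k := by rw [← hlevel, MulEquiv.symm_apply_apply]
  -- The one-sided estimate is applied to the isomorphism and to its inverse.
  have h1 := SymbDyn.mul_entropy_le hX hY (Int.natAbs_pos.2 hk) (Int.natAbs_pos.2 hj)
    Ψ.toMonoidHom Ψ.injective (SymbDyn.commute_map_of_map_level _ hlevel) hlima hlimb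
  have h2 := SymbDyn.mul_entropy_le hY hX (Int.natAbs_pos.2 hj) (Int.natAbs_pos.2 hk)
    Ψ.symm.toMonoidHom Ψ.symm.injective (SymbDyn.commute_map_of_map_level _ hlevel') hlimb hlima
  have h3 : |(k : ℝ)| * a = |(j : ℝ)| * b := by
    simpa [Nat.cast_natAbs] using le_antisymm h1 h2
  have hk' : |(k : ℝ)| ≠ 0 := by simpa using hk
  have hratio : a / b = |(j : ℝ)| / |(k : ℝ)| := by
    rw [div_eq_div_iff hb.ne' hk', mul_comm, h3]
  refine ⟨a, b, ha, hb, hXa, hYb, hratio, (|j| : ℚ) / (|k| : ℚ), ?_⟩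
  rw [hratio]
  push_cast
  rfl
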